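/- An \emph{algebra} for an endofunctor $F\colon \mathcal{C}\to\mathcal{C}$ is a pair $(A,a)$ consisting of an object $A$ of $\mathcal{C}$ and a morphism $a\colon FA\to A$; an algebra morphism $(A,a)\to(B,b)$ is a morphism $h\colon A\to B$ of $\mathcal{C}$ with $h\circ a=b\circ Fh$. An \emph{initial algebra} of $F$ is an initial object of the category of $F$-algebras, and a \emph{pre-fixed point} of $F$ is an $F$-algebra $(A,a)$ whose structure $a\colon FA\to A$ is a monomorphism. Let $\mathcal{C}$ be one of the following categories: the category $\mathsf{Set}$ of sets and functions, the category $\mathsf{Pfn}$ of sets and partial functions, or, for a field $K$, the category $K\text{-}\mathsf{Vec}$ of vector spaces over $K$ and linear maps. Then an arbitrary endofunctor $F\colon\mathcal{C}\to\mathcal{C}$ has an initial algebra if and only if it has a pre-fixed point. -/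

import Mathlib

universe v u w x

open CategoryTheory

namespace InitialAlgebraTheorem

variable {C : Type u} [Category.{v} C]

/-- The endofunctor `F` has an initial algebra: an initial object of the category of
`F`-algebras. -/
def HasInitialAlgebra (F : C ⥤ C) : Prop :=
  ∃ I : Endofunctor.Algebra F, Nonempty (Limits.IsInitial I)

/-- The endofunctor `F` has a pre-fixed point: an `F`-algebra whose structure morphism
`F A ⟶ A` is a monomorphism. -/
def HasPreFixedPoint (F : C ⥤ C) : Prop :=
  ∃ A : Endofunctor.Algebra F, Mono A.str

end InitialAlgebraTheorem

/-!
An initial algebra is a pre-fixed point because its structure morphism is invertible (Lambek).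

For the converse, let `a : F A ⟶ A` be a monomorphism. Consider the subobjects `m : M ⟶ A`
carrying a coalgebra structure `c : M ⟶ F M` with `c ≫ F m ≫ a = m` that is *recursive*: every
algebra `B` receives exactly one `h : M ⟶ B` with `h = c ≫ F h ≫ b`. When `F m` is monic, the
composite `F m ≫ a` makes `F M` another such subobject, and it contains `M` (via `c`). When unions
of chains of subobjects of `A` are colimits, the union of a chain of such subobjects is again one
(`RecursiveSubcoalgebra.exists_upperBound`). By Zorn's lemma there is a maximal one; it equals
`F M` as a subobject, so `c` is invertible, and recursiveness says precisely that `(M, c⁻¹)` is an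
initial algebra (`HasInitialAlgebra.of_recursiveSubcoalgebra`). This avoids transfinite iteration
of `F`.

In vector spaces and in sets with partial functions every monomorphism splits, so every `F`
preserves monomorphisms, and the zero object starts the argument. In sets, monomorphisms with
nonempty domain split, so a nonempty starting point is needed. If `F ∅` is empty, then `∅` is an
initial algebra. Otherwise the image of `F ∅ ⟶ F A ⟶ A` is nonempty, and it is a recursive
subcoalgebra because the kernel of `F ∅ ⟶ F X` is the same for all nonempty `X`
(`exists_recursiveSubcoalgebra_of_nonempty`).
-/

/-! ### Recursive subcoalgebras of a pre-fixed point -/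

namespace InitialAlgebraTheorem

section General

variable {C : Type u} [Category.{v} C] {F : C ⥤ C}

/-- Every nonempty chain of subobjects of `A` has an upper bound `T` in the subobjects of `A` which
is also its colimit. The chain is given by representing monomorphisms `s i`, so two indices may
name the same subobject; a cocone on it is a family `h` compatible with all inclusions. -/
def HasSmoothChains (A : C) : Prop :=
  ∀ (ι : Type (max u v)) [Nonempty ι] (S : ι → C) (s : ∀ i, S i ⟶ A), (∀ i, Mono (s i)) →
    (∀ i j, (∃ u, u ≫ s j = s i) ∨ ∃ u, u ≫ s i = s j) →
    ∃ (T : C) (t : T ⟶ A) (κ : ∀ i, S i ⟶ T), Mono t ∧ (∀ i, κ i ≫ t = s i) ∧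
      ∀ (B : C) (h : ∀ i, S i ⟶ B), (∀ i j (u : S i ⟶ S j), u ≫ s j = s i → u ≫ h j = h i) →
        ∃! g : T ⟶ B, ∀ i, κ i ≫ g = h i

/-- A coalgebra is recursive when every algebra receives a unique coalgebra-to-algebra morphism
from it. -/
def IsRecursive (V : Endofunctor.Coalgebra F) : Prop :=
  ∀ B : Endofunctor.Algebra F, ∃! h : V.V ⟶ B.a, V.str ≫ F.map h ≫ B.str = h

theorem IsRecursive.obj {V : Endofunctor.Coalgebra F} (hV : IsRecursive V) :
    IsRecursive (F := F) ⟨F.obj V.V, F.map V.str⟩ := by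
  intro B
  obtain ⟨h, hh, huniq⟩ := hV B
  refine ⟨F.map h ≫ B.str, ?_, fun g hg => ?_⟩
  · dsimp only
    rw [← F.map_comp_assoc, hh]
  · have : V.str ≫ g = h := by
      apply huniq
      dsimp only at hg ⊢
      rw [Functor.map_comp, Category.assoc, hg]
    dsimp only at hg
    rw [← hg, ← this, Functor.map_comp, Category.assoc]

/-- A recursive coalgebra `V` with a monomorphism `incl : V ⟶ A` into the algebra `A` that is a
coalgebra-to-algebra morphism. -/
structure RecursiveSubcoalgebra (A : Endofunctor.Algebra F) extends Endofunctor.Coalgebra F where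
  incl : V ⟶ A.a
  mono_incl : Mono incl
  str_incl : str ≫ F.map incl ≫ A.str = incl
  isRecursive : IsRecursive toCoalgebra

namespace RecursiveSubcoalgebra

variable {A : Endofunctor.Algebra F}

/-- Inclusion of the underlying subobjects of `A`. -/
def LE (R S : RecursiveSubcoalgebra A) : Prop :=
  ∃ u : R.V ⟶ S.V, u ≫ S.incl = R.incl

theorem LE.refl (R : RecursiveSubcoalgebra A) : R.LE R := ⟨𝟙 _, Category.id_comp _⟩

theorem LE.trans {R S T : RecursiveSubcoalgebra A} : R.LE S → S.LE T → R.LE T := by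
  rintro ⟨u, hu⟩ ⟨w, hw⟩
  exact ⟨u ≫ w, by rw [Category.assoc, hw, hu]⟩

/-- A factorization between subobjects is a coalgebra morphism for structures compatible with
that of `A`. -/
theorem comp_str_eq {M N : C} {m : M ⟶ A.a} {n : N ⟶ A.a} {c : M ⟶ F.obj M} {d : N ⟶ F.obj N}
    (hc : c ≫ F.map m ≫ A.str = m) (hd : d ≫ F.map n ≫ A.str = n)
    (hn : Mono (F.map n ≫ A.str)) {u : M ⟶ N} (hu : u ≫ n = m) : u ≫ d = c ≫ F.map u := by
  rw [← cancel_mono (F.map n ≫ A.str)]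
  simp only [Category.assoc]
  rw [hd, hu, ← F.map_comp_assoc, hu, hc]

/-- The subobject `F R` of `A`, which is again a recursive subcoalgebra. -/
def next (R : RecursiveSubcoalgebra A) (h : Mono (F.map R.incl ≫ A.str)) :
    RecursiveSubcoalgebra A where
  V := F.obj R.V
  str := F.map R.str
  incl := F.map R.incl ≫ A.str
  mono_incl := h
  str_incl := by
    rw [← F.map_comp_assoc, R.str_incl]
  isRecursive := R.isRecursive.obj

theorem isIso_str_of_maximal (R : RecursiveSubcoalgebra A) (h : Mono (F.map R.incl ≫ A.str))
    (hR : (R.next h).LE R) : IsIso R.str := by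
  obtain ⟨w, hw⟩ : ∃ w : F.obj R.V ⟶ R.V, w ≫ R.incl = F.map R.incl ≫ A.str := hR
  have := R.mono_incl
  refine ⟨w, ?_, ?_⟩
  · rw [← cancel_mono R.incl, Category.assoc, hw, R.str_incl, Category.id_comp]
  · rw [← cancel_mono (F.map R.incl ≫ A.str), Category.assoc, R.str_incl, hw, Category.id_comp]

/-- The colimit of a chain of recursive subcoalgebras inherits a coalgebra structure, and the unique
morphisms into an algebra glue. The subobject `R₀` bounds from below the subobjects on which `F` is
required to preserve monomorphisms. -/
theorem exists_upperBound (hA : HasSmoothChains A.a) (R₀ : RecursiveSubcoalgebra A)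
    (hF : ∀ (N : C) (n : N ⟶ A.a) [Mono n], (∃ u, u ≫ n = R₀.incl) → Mono (F.map n ≫ A.str))
    {c : Set (RecursiveSubcoalgebra A)} (hne : c.Nonempty) (hbase : ∀ R ∈ c, R₀.LE R)
    (hchain : IsChain LE c) : ∃ T : RecursiveSubcoalgebra A, ∀ R ∈ c, R.LE T := by
  have := hne.to_subtype
  have hmono (R : c) : Mono R.1.incl := R.1.mono_incl
  obtain ⟨T, t, κ, ht, hκ, hT⟩ := hA c (fun R => R.1.V) (fun R => R.1.incl) hmono (by
    intro R S
    by_cases h : R = S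
    · exact h ▸ Or.inl (LE.refl _)
    · exact hchain R.2 S.2 fun e => h (Subtype.ext e))
  have hκcomp {R S : c} {u : R.1.V ⟶ S.1.V} (hu : u ≫ S.1.incl = R.1.incl) : u ≫ κ S = κ R := by
    rw [← cancel_mono t, Category.assoc, hκ, hκ, hu]
  -- The colimit injections are jointly epic.
  have joint {B : C} {g g' : T ⟶ B} (h : ∀ R, κ R ≫ g = κ R ≫ g') : g = g' := by
    refine (hT B (fun R => κ R ≫ g') fun R S u hu => ?_).unique h fun _ => rfl
    rw [← Category.assoc, hκcomp hu]
  have hmono' (R : c) : Mono (F.map R.1.incl ≫ A.str) := hF _ _ (hbase R.1 R.2)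
  have hcoalg (R S : c) (u : R.1.V ⟶ S.1.V) (hu : u ≫ S.1.incl = R.1.incl) :
      u ≫ S.1.str = R.1.str ≫ F.map u :=
    comp_str_eq R.1.str_incl S.1.str_incl (hmono' S) hu
  obtain ⟨d, hd, -⟩ := hT (F.obj T) (fun R => R.1.str ≫ F.map (κ R)) fun R S u hu => by
    rw [← Category.assoc, hcoalg R S u hu, Category.assoc, ← F.map_comp, hκcomp hu]
  refine ⟨⟨⟨T, d⟩, t, ht, joint fun R => ?_, fun B => ?_⟩, fun R hR => ⟨κ ⟨R, hR⟩, hκ _⟩⟩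
  · rw [reassoc_of% hd R, ← F.map_comp_assoc, hκ, R.1.str_incl]
  · choose h hh huniq using fun R : c => R.1.isRecursive B
    obtain ⟨g, hg, -⟩ := hT B.a h fun R S u hu => by
      refine huniq R _ ?_
      dsimp only
      rw [F.map_comp, Category.assoc, ← reassoc_of% hcoalg R S u hu]
      exact congrArg (u ≫ ·) (hh S)
    refine ⟨g, joint fun R => ?_, fun g' hg' => joint fun R => ?_⟩
    · dsimp only
      rw [reassoc_of% hd R, ← F.map_comp_assoc, hg]
      exact hh R
    · rw [hg]
      refine huniq R _ ?_
      dsimp only at hg' ⊢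
      rw [F.map_comp, Category.assoc, ← reassoc_of% hd R, hg']

end RecursiveSubcoalgebra

/-! ### Initial algebras from recursive subcoalgebras -/

theorem HasInitialAlgebra.of_isRecursive (V : Endofunctor.Coalgebra F) (hV : IsRecursive V)
    (hiso : IsIso V.str) : HasInitialAlgebra F := by
  choose h hh huniq using hV
  refine ⟨⟨V.V, inv V.str⟩, ⟨Limits.IsInitial.ofUniqueHom (fun B => ⟨h B, ?_⟩) fun B m => ?_⟩⟩
  · rw [IsIso.eq_inv_comp]
    exact hh B
  · ext
    refine huniq B _ ?_
    have := m.h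
    dsimp only at this ⊢
    rw [this, IsIso.hom_inv_id_assoc]

theorem HasInitialAlgebra.hasPreFixedPoint (h : HasInitialAlgebra F) : HasPreFixedPoint F := by
  obtain ⟨I, ⟨hI⟩⟩ := h
  have := Endofunctor.Algebra.Initial.str_isIso hI
  exact ⟨I, inferInstance⟩

theorem HasInitialAlgebra.of_recursiveSubcoalgebra {A : Endofunctor.Algebra F}
    (hA : HasSmoothChains A.a) (R₀ : RecursiveSubcoalgebra A)
    (hF : ∀ (N : C) (n : N ⟶ A.a) [Mono n], (∃ u, u ≫ n = R₀.incl) → Mono (F.map n ≫ A.str)) :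
    HasInitialAlgebra F := by
  have : Nonempty {R : RecursiveSubcoalgebra A // R₀.LE R} := ⟨R₀, .refl R₀⟩
  obtain ⟨⟨R, hR₀⟩, hR⟩ := exists_maximal_of_nonempty_chains_bounded
    (r := fun R S : {R : RecursiveSubcoalgebra A // R₀.LE R} => R.1.LE S.1)
    (fun c hc hne => by
      obtain ⟨T, hT⟩ := RecursiveSubcoalgebra.exists_upperBound hA R₀ hF
        (c := Subtype.val '' c) (hne.image _) (by rintro _ ⟨R, -, rfl⟩; exact R.2) (by
          rintro _ ⟨R, hR, rfl⟩ _ ⟨S, hS, rfl⟩ hRS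
          exact hc hR hS fun e => hRS (congrArg _ e))
      obtain ⟨R, hR⟩ := hne
      exact ⟨⟨T, R.2.trans (hT _ ⟨R, hR, rfl⟩)⟩, fun S hS => hT _ ⟨S, hS, rfl⟩⟩)
    fun h h' => h.trans h'
  have := R.mono_incl
  have hmono : Mono (F.map R.incl ≫ A.str) := hF _ _ hR₀
  have hle : R.LE (R.next hmono) := ⟨R.str, R.str_incl⟩
  exact .of_isRecursive R.toCoalgebra R.isRecursive
    (R.isIso_str_of_maximal hmono (hR ⟨_, hR₀.trans hle⟩ hle))

/-- In a category with split monomorphisms every functor preserves monomorphisms, and a zero object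
is a recursive subcoalgebra of every algebra. -/
theorem hasInitialAlgebra_iff_of_splitMonoCategory [SplitMonoCategory C] [Limits.HasZeroObject C]
    (hC : ∀ A : C, HasSmoothChains A) (F : C ⥤ C) : HasInitialAlgebra F ↔ HasPreFixedPoint F := by
  refine ⟨HasInitialAlgebra.hasPreFixedPoint, fun ⟨A, hA⟩ => ?_⟩
  obtain ⟨Z, hZ⟩ := Limits.HasZeroObject.zero (C := C)
  refine .of_recursiveSubcoalgebra (hC A.a)
    { V := Z
      str := hZ.to_ _
      incl := hZ.to_ _
      mono_incl := ⟨fun _ _ _ => hZ.eq_of_tgt _ _⟩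
      str_incl := hZ.eq_of_src _ _
      isRecursive := fun B => ⟨hZ.to_ _, hZ.eq_of_src _ _, fun _ _ => hZ.eq_of_src _ _⟩ }
    fun N n _ _ => ?_
  have := isSplitMono_of_mono n
  infer_instance

end General

/-! ### Sets and functions -/

section Types

theorem hasSmoothChains_type (A : Type u) : HasSmoothChains A := by
  intro ι _ S s hs hdir
  have hinj (i) : Function.Injective (s i) := (mono_iff_injective _).1 (hs i)
  refine ⟨{a // ∃ i x, s i x = a}, ↾Subtype.val, fun i => ↾fun x => ⟨s i x, i, x, rfl⟩,
    (mono_iff_injective _).2 Subtype.val_injective, fun i => rfl, fun B h hh => ?_⟩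
  -- Compatible maps agree on elements with the same image in `A`.
  have key {i j} {x : S i} {y : S j} (e : s i x = s j y) : h i x = h j y := by
    wlog hij : ∃ u, u ≫ s j = s i generalizing i j
    · exact (this e.symm ((hdir i j).resolve_left hij)).symm
    obtain ⟨u, hu⟩ := hij
    have : u x = y := hinj j (by rw [← e, ← hu]; rfl)
    rw [← hh i j u hu, ← this]; rfl
  choose i x hx using fun z : {a // ∃ i x, s i x = a} => z.2
  refine ⟨↾fun z => h (i z) (x z), fun j => ?_, fun g hg => ?_⟩
  · ext y
    exact key (hx _)
  · ext z
    have := ConcreteCategory.congr_hom (hg (i z)) (x z)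
    have e : (⟨s (i z) (x z), i z, x z, rfl⟩ : {a // ∃ i x, s i x = a}) = z := Subtype.ext (hx z)
    dsimp at this ⊢
    rw [← this, e]

theorem isSplitMono_type {X Y : Type u} [Nonempty X] (f : X ⟶ Y) [Mono f] : IsSplitMono f :=
  ⟨⟨⟨↾Function.invFun f, by
    ext x
    exact Function.leftInverse_invFun ((mono_iff_injective f).1 inferInstance) x⟩⟩⟩

/-- The unique map from the empty type. -/
def fromEmpty (X : Type u) : PEmpty.{u + 1} ⟶ X := ↾PEmpty.elim

theorem fromEmpty_comp {X Y : Type u} (f : X ⟶ Y) : fromEmpty X ≫ f = fromEmpty Y := by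
  ext x
  exact x.elim

/-- The kernel of `F ∅ ⟶ F Y` contains that of `F ∅ ⟶ F X` as soon as `Y` is nonempty, since then
there is a map `X ⟶ Y`. -/
theorem map_fromEmpty_eq (F : Type u ⥤ Type u) {X Y : Type u} [Nonempty Y] {p q : F.obj PEmpty}
    (h : F.map (fromEmpty X) p = F.map (fromEmpty X) q) :
    F.map (fromEmpty Y) p = F.map (fromEmpty Y) q := by
  let f : X ⟶ Y := ↾fun _ => Classical.arbitrary Y
  rw [← fromEmpty_comp f, F.map_comp]
  exact congrArg (F.map f) h

/-- The image of a map, as an object of the category of types. -/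
abbrev Image {X Y : Type u} (e : X ⟶ Y) : Type u := {y : Y // ∃ x, e x = y}

/-- The corestriction of a map to its image. -/
def Image.proj {X Y : Type u} (e : X ⟶ Y) : X ⟶ Image e := ↾fun x => ⟨e x, x, rfl⟩

theorem Image.existsUnique_lift {X Y Z : Type u} (e : X ⟶ Y) (f : X ⟶ Z)
    (h : ∀ p q, e p = e q → f p = f q) :
    ∃! g : Image e ⟶ Z, proj e ≫ g = f := by
  choose r hr using fun y : Image e => y.2
  refine ⟨↾fun y => f (r y), ?_, fun g hg => ?_⟩
  · ext x
    exact h _ _ (hr _)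
  · ext y
    have := ConcreteCategory.congr_hom hg (r y)
    have e' : proj e (r y) = y := Subtype.ext (hr y)
    dsimp at this ⊢
    rw [← this, e']

/-- The image of `F ∅ ⟶ F A ⟶ A` is a recursive subcoalgebra. A map out of it is a map out of `F ∅`
that identifies the points identified in `A`; both the coalgebra structure and the maps into
algebras arise from such maps. -/
theorem exists_recursiveSubcoalgebra_of_nonempty {F : Type u ⥤ Type u} (A : Endofunctor.Algebra F)
    [Mono A.str] [Nonempty (F.obj PEmpty)] :
    ∃ R : RecursiveSubcoalgebra A, Nonempty R.V := by
  let e : F.obj PEmpty ⟶ A.a := F.map (fromEmpty A.a) ≫ A.str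
  let π : F.obj PEmpty ⟶ Image e := Image.proj e
  let incl : Image e ⟶ A.a := ↾Subtype.val
  have hker {p q} (h : e p = e q) : F.map (fromEmpty A.a) p = F.map (fromEmpty A.a) q :=
    (mono_iff_injective A.str).1 inferInstance h
  have hπ : Epi π := (epi_iff_surjective _).2 fun ⟨_, x, hx⟩ => ⟨x, Subtype.ext hx⟩
  have hne : Nonempty (Image e) := .map π inferInstance
  obtain ⟨c, hc, -⟩ : ∃! c, π ≫ c = F.map (fromEmpty (Image e)) :=
    Image.existsUnique_lift e _ fun p q h => map_fromEmpty_eq F (hker h)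
  have hc' {Z W : Type u} (k : Image e ⟶ Z) (l : F.obj Z ⟶ W) :
      π ≫ c ≫ F.map k ≫ l = F.map (fromEmpty Z) ≫ l := by
    rw [reassoc_of% hc, ← F.map_comp_assoc, fromEmpty_comp]
  refine ⟨⟨⟨Image e, c⟩, incl, (mono_iff_injective _).2 Subtype.val_injective, ?_,
    fun B => ?_⟩, hne⟩
  · rw [← cancel_epi π, hc']
    rfl
  · have : Nonempty B.a := .map (F.map (fromEmpty B.a) ≫ B.str) ‹Nonempty (F.obj PEmpty)›
    obtain ⟨h, hh, huniq⟩ : ∃! h, π ≫ h = F.map (fromEmpty B.a) ≫ B.str :=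
      Image.existsUnique_lift e _ fun p q h => congrArg B.str (map_fromEmpty_eq F (hker h))
    refine ⟨h, ?_, fun g hg => huniq g ?_⟩
    · dsimp only
      rw [← cancel_epi π, hc', hh]
    · dsimp only at hg ⊢
      rw [← hc' g, hg]

theorem hasInitialAlgebra_iff_type (F : Type u ⥤ Type u) :
    HasInitialAlgebra F ↔ HasPreFixedPoint F := by
  refine ⟨HasInitialAlgebra.hasPreFixedPoint, fun ⟨A, hA⟩ => ?_⟩
  rcases isEmpty_or_nonempty (F.obj PEmpty) with hF | hF
  · refine .of_isRecursive ⟨PEmpty, fromEmpty _⟩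
      (fun B => ⟨fromEmpty _, fromEmpty_comp _, fun g _ => ?_⟩) ?_
    · ext x
      exact x.elim
    · rw [isIso_iff_bijective]
      exact ⟨fun x => x.elim, fun x => hF.elim x⟩
  · obtain ⟨R₀, hR₀⟩ := exists_recursiveSubcoalgebra_of_nonempty A
    refine .of_recursiveSubcoalgebra (hasSmoothChains_type A.a) R₀ fun N n _ ⟨u, _⟩ => ?_
    have : Nonempty N := hR₀.map u
    have := isSplitMono_type n
    infer_instance

end Types

/-! ### Sets and partial functions -/

section PartialFun

namespace Pfn

variable {X Y Z : PartialFun.{v}}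

/-- The value of a morphism of `PartialFun` at a point, undefined outside its domain. -/
def app (f : X ⟶ Y) (x : X) : Part Y := f x

theorem hom_ext {f g : X ⟶ Y} (h : ∀ x, app f x = app g x) : f = g := funext h

/-- A total function as a morphism of `PartialFun`. -/
def ofFun (f : X → Y) : X ⟶ Y := (PFun.lift f : X →. Y)

theorem app_ofFun_comp (f : X → Y) (g : Y ⟶ Z) (x : X) : app (ofFun f ≫ g) x = app g (f x) :=
  Part.bind_some _ _

/-- A partial function as a morphism of `PartialFun`. -/
def ofPart (f : X → Part Y) : X ⟶ Y := (f : X →. Y)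

theorem app_ofPart (f : X → Part Y) (x : X) : app (ofPart f) x = f x := rfl

theorem isZero_empty : Limits.IsZero (PartialFun.of PEmpty.{v + 1}) where
  unique_to Y := ⟨⟨⟨ofFun fun x => PEmpty.elim x⟩, fun _ => hom_ext fun x => PEmpty.elim x⟩⟩
  unique_from Y := ⟨⟨⟨ofPart fun _ => Part.none⟩, fun f => hom_ext fun x => by
    refine Part.ext fun y => ?_
    exact PEmpty.elim y⟩⟩

instance : Limits.HasZeroObject PartialFun.{v} := ⟨⟨_, isZero_empty⟩⟩

/-- Monomorphisms are total and injective: a point is a morphism from the one-point set, which can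
be compared with the nowhere defined morphism and with other points. -/
theorem exists_eq_ofFun_of_mono (f : X ⟶ Y) [Mono f] :
    ∃ g : X → Y, Function.Injective g ∧ f = ofFun g := by
  have hdom (x : X) : (app f x).Dom := by
    by_contra hx
    have hx : app f x = Part.none := Part.eq_none_iff'.2 hx
    have : (ofFun fun _ => x : PartialFun.of PUnit ⟶ X) = ofPart fun _ => Part.none := by
      rw [← cancel_mono f]
      refine hom_ext fun z => ?_
      rw [app_ofFun_comp, hx]
      exact (Part.bind_none _).symm
    have := congrArg (fun k => app k PUnit.unit) this
    exact Part.some_ne_none x this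
  have hf : f = ofFun fun x => (app f x).get (hdom x) := hom_ext fun x => (Part.some_get _).symm
  refine ⟨_, fun x y hxy => ?_, hf⟩
  have : (ofFun fun _ => x : PartialFun.of PUnit ⟶ X) = ofFun fun _ => y := by
    rw [← cancel_mono f, hf]
    refine hom_ext fun z => ?_
    rw [app_ofFun_comp, app_ofFun_comp]
    exact congrArg Part.some hxy
  exact Part.some_injective (congrArg (fun k => app k PUnit.unit) this)

theorem isSplitMono_ofFun {f : X → Y} (hf : Function.Injective f) : IsSplitMono (ofFun f) := by
  classical
  refine ⟨⟨⟨ofPart fun y => ⟨∃ x, f x = y, fun h => h.choose⟩, hom_ext fun x => ?_⟩⟩⟩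
  rw [app_ofFun_comp, app_ofPart]
  have h : ∃ x', f x' = f x := ⟨x, rfl⟩
  exact Part.ext' ⟨fun _ => trivial, fun _ => h⟩ fun _ _ => hf h.choose_spec

instance : SplitMonoCategory PartialFun.{v} where
  isSplitMono_of_mono f _ := by
    obtain ⟨g, hg, rfl⟩ := exists_eq_ofFun_of_mono f
    exact isSplitMono_ofFun hg

theorem hasSmoothChains (A : PartialFun.{v}) : HasSmoothChains A := by
  intro ι _ S s hs hdir
  choose s' hinj hs' using fun i => exists_eq_ofFun_of_mono (s i)
  let T : PartialFun.{v} := PartialFun.of {a : A // ∃ i x, s' i x = a}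
  let t : T → A := Subtype.val
  let k (i) (x : S i) : T := ⟨s' i x, i, x, rfl⟩
  refine ⟨T, ofFun t, fun i => ofFun (k i), ?_, fun i => ?_, fun B h hh => ?_⟩
  · have := isSplitMono_ofFun (f := t) Subtype.val_injective
    infer_instance
  · rw [hs' i]
    exact hom_ext fun x => app_ofFun_comp _ _ _
  -- Compatible maps agree on elements with the same image in `A`.
  have key {i j} {x : S i} {y : S j} (e : s' i x = s' j y) : app (h i) x = app (h j) y := by
    wlog hij : ∃ u, u ≫ s j = s i generalizing i j
    · exact (this e.symm ((hdir i j).resolve_left hij)).symm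
    obtain ⟨u, hu⟩ := hij
    have := hs i
    have := mono_of_mono_fac hu
    obtain ⟨u', -, rfl⟩ := exists_eq_ofFun_of_mono u
    have : s' j (u' x) = s' i x := Part.some_injective <| by
      have : app (ofFun u' ≫ s j) x = app (s i) x := congrArg (fun m => app m x) hu
      rwa [hs' i, hs' j, app_ofFun_comp] at this
    rw [← hh i j _ hu, app_ofFun_comp, hinj j (this.trans e)]
  choose i x hx using fun z : T => z.2
  refine ⟨ofPart fun z => app (h (i z)) (x z), fun j => hom_ext fun y => ?_,
    fun g hg => hom_ext fun z => ?_⟩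
  · rw [app_ofFun_comp, app_ofPart]
    exact key (hx _)
  · have e : k (i z) (x z) = z := Subtype.ext (hx z)
    rw [app_ofPart, ← hg (i z), app_ofFun_comp, e]

end Pfn

end PartialFun

/-! ### Vector spaces -/

section ModuleCat

variable {K : Type w} [Field K]

instance : SplitMonoCategory (ModuleCat.{x} K) where
  isSplitMono_of_mono f hf := by
    obtain ⟨g, hg⟩ := f.hom.exists_leftInverse_of_injective
      (LinearMap.ker_eq_bot.2 ((ModuleCat.mono_iff_injective f).1 hf))
    exact ⟨⟨⟨ModuleCat.ofHom g, ModuleCat.hom_ext hg⟩⟩⟩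

theorem hasSmoothChains_moduleCat (A : ModuleCat.{x} K) : HasSmoothChains A := by
  intro ι _ S s hs hdir
  have hinj (i) : Function.Injective (s i) := (ModuleCat.mono_iff_injective _).1 (hs i)
  have hle {i j} (h : ∃ u, u ≫ s j = s i) : (s i).hom.range ≤ (s j).hom.range := by
    obtain ⟨u, hu⟩ := h
    rw [← hu]
    exact LinearMap.range_comp_le_range _ _
  have hd : Directed (· ≤ ·) fun i => (s i).hom.range := fun i j =>
    (hdir i j).elim (fun h => ⟨j, hle h, le_rfl⟩) fun h => ⟨i, le_rfl, hle h⟩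
  let T : Submodule K A := ⨆ i, (s i).hom.range
  let k (i) : S i →ₗ[K] T := (s i).hom.codRestrict T fun x =>
    le_iSup (fun i => (s i).hom.range) i ⟨x, rfl⟩
  have hk (z : T) : ∃ i x, k i x = z := by
    obtain ⟨i, x, hx⟩ := (Submodule.mem_iSup_of_directed _ hd).1 z.2
    exact ⟨i, x, Subtype.ext hx⟩
  refine ⟨ModuleCat.of K T, ModuleCat.ofHom T.subtype, fun i => ModuleCat.ofHom (k i),
    (ModuleCat.mono_iff_injective _).2 T.injective_subtype, fun i => rfl, fun B h hh => ?_⟩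
  have lift_le {i j} (hij : ∃ u, u ≫ s j = s i) (x : S i) :
      ∃ y : S j, k j y = k i x ∧ h j y = h i x := by
    obtain ⟨u, hu⟩ := hij
    refine ⟨u x, Subtype.ext ?_, ?_⟩
    · exact ConcreteCategory.congr_hom hu x
    · exact ConcreteCategory.congr_hom (hh i j u hu) x
  have kinj (i) : Function.Injective (k i) := fun x y e => hinj i (congrArg Subtype.val e)
  -- Compatible maps agree on elements with the same image in `T`.
  have key {i j} {x : S i} {y : S j} (e : k i x = k j y) : h i x = h j y := by
    rcases hdir i j with hij | hij
    · obtain ⟨x', hx', hhx'⟩ := lift_le hij x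
      rw [← hhx', kinj j (hx'.trans e)]
    · obtain ⟨y', hy', hhy'⟩ := lift_le hij y
      rw [← hhy', kinj i (hy'.trans e.symm)]
  choose i x hx using hk
  have hx' {j} {y : S j} {z : T} (e : k j y = z) : h (i z) (x z) = h j y :=
    key ((hx z).trans e.symm)
  let g : T →ₗ[K] B :=
    { toFun z := h (i z) (x z)
      map_add' z₁ z₂ := by
        rcases hdir (i z₁) (i z₂) with hij | hij
        · obtain ⟨y, hy, hhy⟩ := lift_le hij (x z₁)
          rw [← hhy, ← map_add]
          exact hx' (by rw [map_add, hy, hx, hx])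
        · obtain ⟨y, hy, hhy⟩ := lift_le hij (x z₂)
          rw [← hhy, ← map_add]
          exact hx' (by rw [map_add, hy, hx, hx])
      map_smul' r z := by
        rw [RingHom.id_apply, ← map_smul]
        exact hx' (by rw [map_smul, hx]) }
  refine ⟨ModuleCat.ofHom g, fun j => ?_, fun g' hg' => ?_⟩
  · ext y
    exact hx' rfl
  · ext z
    have := ConcreteCategory.congr_hom (hg' (i z)) (x z)
    dsimp at this
    rw [hx] at this
    exact this

end ModuleCat

end InitialAlgebraTheorem

theorem mainTheorem8 :
    (∀ F : Type u ⥤ Type u,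
      InitialAlgebraTheorem.HasInitialAlgebra F ↔ InitialAlgebraTheorem.HasPreFixedPoint F) ∧
    (∀ F : PartialFun.{v} ⥤ PartialFun.{v},
      InitialAlgebraTheorem.HasInitialAlgebra F ↔ InitialAlgebraTheorem.HasPreFixedPoint F) ∧
    (∀ (K : Type w) [Field K] (F : ModuleCat.{x} K ⥤ ModuleCat.{x} K),
      InitialAlgebraTheorem.HasInitialAlgebra F ↔ InitialAlgebraTheorem.HasPreFixedPoint F) :=
  ⟨InitialAlgebraTheorem.hasInitialAlgebra_iff_type,
    InitialAlgebraTheorem.hasInitialAlgebra_iff_of_splitMonoCategory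
      InitialAlgebraTheorem.Pfn.hasSmoothChains,
    fun _ _ => InitialAlgebraTheorem.hasInitialAlgebra_iff_of_splitMonoCategory
      InitialAlgebraTheorem.hasSmoothChains_moduleCat⟩
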